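/- Let $n$ be a positive integer. For a permutation $\pi=\pi_1\pi_2\cdots\pi_n$ of $[n]=\{1,\dots,n\}$ let $\ell(\pi)$ be the length of a longest increasing subsequence of $\pi$, and let the shape of $\pi$ be the partition of $n$ that is the common shape of the two standard Young tableaux which the Robinson–Schensted (row insertion) correspondence assigns to $\pi$. A hook shape is a partition of $n$ of the form $(j,1^{n-j})$ with $1\le j\le n$, that is, with first part $j$ and $n-j$ further parts all equal to $1$. For $1\le k\le n$ let $\ell_{n,k}^{\mathrm{hook}}$ be the number of permutations $\pi$ of $[n]$ whose shape is a hook shape and for which $\ell(\pi)=k$, and let $i_{n,k}^{\mathrm{hook}}$ be the number of those among them that are involutions, i.e. satisfy $\pi^2=\mathrm{id}$. A finite sequence of real numbers $a_1,\dots,a_n$ is called log concave if $a_{k-1}a_{k+1}\le a_k^2$ for all $1\le k\le n$, where $a_0=a_{n+1}=0$ by convention. Then for every $n$ both sequences $$\ell_{n,1}^{\mathrm{hook}},\ \ell_{n,2}^{\mathrm{hook}},\dots,\ell_{n,n}^{\mathrm{hook}}\qquad\text{and}\qquad i_{n,1}^{\mathrm{hook}},\ i_{n,2}^{\mathrm{hook}},\dots,i_{n,n}^{\mathrm{hook}}$$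 are log concave. -/

import Mathlib

namespace HookLIS

/-- Row insertion of `x` into an increasing row: `x` replaces the leftmost entry larger than `x`,
which is returned as the bumped entry; if there is no such entry, `x` is appended at the end of the
row and nothing is bumped. -/
def rowInsert (x : ℕ) : List ℕ → List ℕ × Option ℕ
  | [] => ([x], none)
  | y :: ys =>
    if x < y then (x :: ys, some y)
    else (y :: (rowInsert x ys).1, (rowInsert x ys).2)

/-- Robinson-Schensted insertion of `x` into a tableau, given as its list of rows from top to
bottom: `x` is row inserted into the first row, the bumped entry (if any) into the next row,
and so on. -/
def tableauInsert : ℕ → List (List ℕ) → List (List ℕ)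
  | x, [] => [[x]]
  | x, r :: rs =>
    match rowInsert x r with
    | (r', none) => r' :: rs
    | (r', some y) => r' :: tableauInsert y rs

/-- The insertion tableau `P` of a word: its letters are inserted from left to right into the empty
tableau. -/
def insertionTableau (w : List ℕ) : List (List ℕ) :=
  w.foldl (fun T x => tableauInsert x T) []

/-- The one-line notation `π₁ π₂ … πₙ` of a permutation of `[n]`; `Fin n` is `{0, …, n - 1}`, so
values are shifted by one. -/
def word {n : ℕ} (π : Equiv.Perm (Fin n)) : List ℕ :=
  List.ofFn fun i => (π i : ℕ) + 1

/-- The shape of a permutation: the row lengths `(λ₁, λ₂, …)` of its Robinson-Schensted output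
tableau `P` (the recording tableau `Q` has the same shape by construction). -/
def shape {n : ℕ} (π : Equiv.Perm (Fin n)) : List ℕ :=
  (insertionTableau (word π)).map List.length

/-- `ℓ(π)`, the length of a longest increasing subsequence of `π`: the largest cardinality of a set
of positions on which `π` is increasing. -/
def lis {n : ℕ} (π : Equiv.Perm (Fin n)) : ℕ :=
  ((Finset.univ : Finset (Finset (Fin n))).filter
    fun S => ∀ i ∈ S, ∀ j ∈ S, i < j → π i < π j).sup Finset.card

/-- The hook shapes `(k, 1^{n-k})`, `1 ≤ k ≤ n`. -/
def hook (n : ℕ) : Set (List ℕ) :=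
  {lam | ∃ k, 1 ≤ k ∧ k ≤ n ∧ lam = k :: List.replicate (n - k) 1}

/-- `ℓ_{n,k}^Λ`: the number of permutations `π` of `[n]` with `ℓ(π) = k` and shape in `Λ`. -/
noncomputable def permCount (n : ℕ) (Lam : Set (List ℕ)) (k : ℕ) : ℕ :=
  Set.ncard {π : Equiv.Perm (Fin n) | lis π = k ∧ shape π ∈ Lam}

/-- `i_{n,k}^Λ`: the number of involutions `π` of `[n]` (permutations whose square is the identity)
with `ℓ(π) = k` and shape in `Λ`. -/
noncomputable def involCount (n : ℕ) (Lam : Set (List ℕ)) (k : ℕ) : ℕ :=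
  Set.ncard {π : Equiv.Perm (Fin n) | π ^ 2 = 1 ∧ lis π = k ∧ shape π ∈ Lam}

/-- The entry with index `j` of the finite sequence `a 1, …, a n`, with the convention that entries
with index outside `1, …, n` are `0`. -/
noncomputable def entry (n : ℕ) (a : ℕ → ℝ) (j : ℕ) : ℝ :=
  if 1 ≤ j ∧ j ≤ n then a j else 0

/-- The finite real sequence `a 1, a 2, …, a n` is log concave:
`a (k - 1) * a (k + 1) ≤ (a k) ^ 2` for `1 ≤ k ≤ n`, where `a 0 = a (n + 1) = 0` by convention. -/
def IsLogConcave (n : ℕ) (a : ℕ → ℝ) : Prop :=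
  ∀ k, 1 ≤ k → k ≤ n → entry n a (k - 1) * entry n a (k + 1) ≤ entry n a k ^ 2

end HookLIS

/-! The two counts are explicit: for `1 ≤ k ≤ n` there are `(n - 1).choose (k - 1) ^ 2` hook-shaped
permutations of `[n]` with longest increasing subsequence of length `k`, and
`(n - 1).choose (k - 1)` involutions among them (`permCount_hook`, `involCount_hook`). Log concavity
then follows from that of a row of Pascal's triangle.

When all intermediate tableaux are hooks, inserting a letter either extends the first row or bumps a
single entry from the row to the top of the column below the corner. The inductive predicate
`HookRun` records such an insertion process. Reverse insertion shows that the final tableau and the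
record of extensions and bumps determine the word (`HookRun.word_unique`) and may be prescribed
freely (`HookRun.exists_of_tableau`). Extensions are exactly the ascents of the permutation
(`HookRun.ascents_getElem?`), and the first row of the tableau is given by the ascents of the inverse
permutation (`HookRun.mem_row_iff`). So a hook-shaped permutation corresponds to a pair of equally
large sets of ascents, one for it and one for its inverse (`eq_of_ascents_eq`, `exists_ascents_eq`).

For involutions the two sets agree. Conversely, if they agree then `π` and `π⁻¹` have the same
pair of sets, hence are equal, provided `π⁻¹` is hook-shaped too (`exists_hookRun_inv`). This holds
because hook shapes are characterized by an increasing and a decreasing subsequence with lengths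
adding up to `n + 1` (`HookRun.exists_increasing`, `HookRun.exists_decreasing`,
`exists_hookRun_of_monotone`). The characterization uses the parts of Schensted's theorem saying that
increasing subsequences are no longer than the first row (`length_le_length_firstRow`) and
decreasing ones no longer than the first column (`length_le_length_insertionTableau`).
-/

namespace HookLIS

/-! ### Row insertion and tableau insertion -/

theorem rowInsert_of_forall_le {x : ℕ} {r : List ℕ} (h : ∀ z ∈ r, z ≤ x) :
    rowInsert x r = (r ++ [x], none) := by
  induction r with
  | nil => rfl
  | cons y ys ih =>
    have hy : ¬ x < y := by simpa using h y (by simp)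
    simp [rowInsert, hy, ih fun z hz => h z (by simp [hz])]

theorem rowInsert_append_cons {x y : ℕ} {p q : List ℕ} (hp : ∀ z ∈ p, z ≤ x) (hxy : x < y) :
    rowInsert x (p ++ y :: q) = (p ++ x :: q, some y) := by
  induction p with
  | nil => simp [rowInsert, hxy]
  | cons z p ih =>
    have hz : ¬ x < z := by simpa using hp z (by simp)
    simp [rowInsert, hz, ih fun z hz => hp z (by simp [hz])]

/-- Either every entry of the row is at most the inserted letter, or the row splits at the leftmost
entry exceeding it, the one that gets bumped. -/
theorem forall_le_or_exists_split (x : ℕ) (r : List ℕ) :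
    (∀ z ∈ r, z ≤ x) ∨ ∃ p y q, r = p ++ y :: q ∧ (∀ z ∈ p, z ≤ x) ∧ x < y := by
  induction r with
  | nil => simp
  | cons z r ih =>
    rcases lt_or_ge x z with h | h
    · exact Or.inr ⟨[], z, r, by simp [h]⟩
    · rcases ih with ih | ⟨p, y, q, rfl, hp, hxy⟩
      · left; simpa [h] using ih
      · exact Or.inr ⟨z :: p, y, q, by simp, by simpa [h] using hp, hxy⟩

theorem tableauInsert_cons_of_forall_le {x : ℕ} {r : List ℕ} (rs : List (List ℕ))
    (h : ∀ z ∈ r, z ≤ x) : tableauInsert x (r :: rs) = (r ++ [x]) :: rs := by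
  simp [tableauInsert, rowInsert_of_forall_le h]

theorem tableauInsert_cons_of_split {x y : ℕ} {p q : List ℕ} (rs : List (List ℕ))
    (hp : ∀ z ∈ p, z ≤ x) (hxy : x < y) :
    tableauInsert x ((p ++ y :: q) :: rs) = (p ++ x :: q) :: tableauInsert y rs := by
  simp [tableauInsert, rowInsert_append_cons hp hxy]

theorem insertionTableau_append_singleton (w : List ℕ) (x : ℕ) :
    insertionTableau (w ++ [x]) = tableauInsert x (insertionTableau w) := by
  simp [insertionTableau]

theorem tableauInsert_sorted (x : ℕ) (T : List (List ℕ))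
    (hT : ∀ r ∈ T, r ≠ [] ∧ r.Pairwise (· ≤ ·)) :
    ∀ r ∈ tableauInsert x T, r ≠ [] ∧ r.Pairwise (· ≤ ·) := by
  induction T generalizing x with
  | nil => simp [tableauInsert]
  | cons r rs ih =>
    have hr := (hT r (by simp)).2
    have hrs : ∀ r ∈ rs, r ≠ [] ∧ r.Pairwise (· ≤ ·) := fun s hs => hT s (by simp [hs])
    rcases forall_le_or_exists_split x r with h | ⟨p, y, q, rfl, hp, hxy⟩
    · rw [tableauInsert_cons_of_forall_le rs h]
      intro s hs
      rcases List.mem_cons.1 hs with rfl | hs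
      · simpa [List.pairwise_append, hr] using h
      · exact hrs s hs
    · rw [tableauInsert_cons_of_split rs hp hxy]
      intro s hs
      rcases List.mem_cons.1 hs with rfl | hs
      · simp only [List.pairwise_append, List.pairwise_cons, List.mem_cons] at hr ⊢
        refine ⟨by simp, hr.1, ⟨fun z hz => hxy.le.trans (hr.2.1.1 z hz), hr.2.1.2⟩, ?_⟩
        rintro a ha b (rfl | hb)
        · exact hp a ha
        · exact hr.2.2 a ha b (Or.inr hb)
      · exact ih y hrs s hs

theorem insertionTableau_sorted (w : List ℕ) :
    ∀ r ∈ insertionTableau w, r ≠ [] ∧ r.Pairwise (· ≤ ·) := by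
  induction w using List.reverseRecOn with
  | nil => simp [insertionTableau]
  | append_singleton w x ih =>
    rw [insertionTableau_append_singleton]
    exact tableauInsert_sorted x _ ih

theorem sum_length_tableauInsert (x : ℕ) (T : List (List ℕ)) :
    ((tableauInsert x T).map List.length).sum = (T.map List.length).sum + 1 := by
  induction T generalizing x with
  | nil => simp [tableauInsert]
  | cons r rs ih =>
    rcases forall_le_or_exists_split x r with h | ⟨p, y, q, rfl, hp, hxy⟩
    · rw [tableauInsert_cons_of_forall_le rs h]
      simp; omega
    · rw [tableauInsert_cons_of_split rs hp hxy]
      simp [ih]; omega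

theorem sum_length_insertionTableau (w : List ℕ) :
    ((insertionTableau w).map List.length).sum = w.length := by
  induction w using List.reverseRecOn with
  | nil => simp [insertionTableau]
  | append_singleton w x ih =>
    rw [insertionTableau_append_singleton, sum_length_tableauInsert, ih]; simp

/-! ### Increasing subsequences and the first row -/

theorem headD_tableauInsert (x : ℕ) (T : List (List ℕ)) :
    (tableauInsert x T).headD [] = (rowInsert x (T.headD [])).1 := by
  cases T with
  | nil => simp [tableauInsert, rowInsert]
  | cons r rs =>
    rcases forall_le_or_exists_split x r with h | ⟨p, y, q, rfl, hp, hxy⟩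
    · simp [tableauInsert_cons_of_forall_le rs h, rowInsert_of_forall_le h]
    · simp [tableauInsert_cons_of_split rs hp hxy, rowInsert_append_cons hp hxy]

theorem countP_lt_le_rowInsert (x b : ℕ) (r : List ℕ) :
    r.countP (· < b) ≤ (rowInsert x r).1.countP (· < b) := by
  rcases forall_le_or_exists_split x r with h | ⟨p, y, q, rfl, hp, hxy⟩
  · simp [rowInsert_of_forall_le h]
  · simp only [rowInsert_append_cons hp hxy, List.countP_append, List.countP_cons, decide_eq_true_eq]
    split_ifs <;> omega

theorem countP_lt_add_one_le_rowInsert {x b : ℕ} {r : List ℕ} (hr : r.Pairwise (· ≤ ·))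
    (hxb : x < b) : r.countP (· < x) + 1 ≤ (rowInsert x r).1.countP (· < b) := by
  have mono : ∀ l : List ℕ, l.countP (· < x) ≤ l.countP (· < b) := fun l =>
    List.countP_mono_left fun z _ hz => by simp only [decide_eq_true_eq] at hz ⊢; omega
  rcases forall_le_or_exists_split x r with h | ⟨p, y, q, rfl, hp, hxy⟩
  · simpa [rowInsert_of_forall_le h, hxb] using mono r
  · have hq : q.countP (· < x) = 0 := by
      rw [List.countP_eq_zero]
      intro z hz
      have := (List.pairwise_cons.1 (List.pairwise_append.1 hr).2.1).1 z hz
      simp only [decide_eq_true_eq]; omega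
    have hy : ¬ y < x := by omega
    have := mono p
    simp only [rowInsert_append_cons hp hxy, List.countP_append, List.countP_cons, hq, hxb, hy,
      decide_eq_true_eq, if_true, if_false]
    omega

/-- The half of Schensted's theorem bounding increasing subsequences: one with all its letters below
`b` is no longer than the part of the first row below `b`. -/
theorem length_le_countP_firstRow {w s : List ℕ} {b : ℕ} (hs : s.Sublist w)
    (hinc : s.Pairwise (· < ·)) (hb : ∀ z ∈ s, z < b) :
    s.length ≤ ((insertionTableau w).headD []).countP (· < b) := by
  induction w using List.reverseRecOn generalizing s b with
  | nil => simp [List.sublist_nil.1 hs]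
  | append_singleton w x ih =>
    rw [insertionTableau_append_singleton, headD_tableauInsert]
    obtain ⟨s₁, s₂, rfl, h₁, h₂⟩ := List.sublist_append_iff.1 hs
    rw [List.pairwise_append] at hinc
    have hrow : ((insertionTableau w).headD []).Pairwise (· ≤ ·) := by
      cases h : insertionTableau w with
      | nil => simp
      | cons r rs => exact (insertionTableau_sorted w r (by simp [h])).2
    rcases List.sublist_singleton.1 h₂ with rfl | rfl
    · have := ih h₁ hinc.1 fun z hz => hb z (by simp [hz])
      simpa using this.trans (countP_lt_le_rowInsert x b _)
    · have := ih h₁ hinc.1 fun z hz => hinc.2.2 z hz x (by simp)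
      have h' := countP_lt_add_one_le_rowInsert (b := b) hrow (hb x (by simp))
      simp only [List.length_append, List.length_singleton]
      omega

theorem length_le_length_firstRow {w s : List ℕ} (hs : s.Sublist w)
    (hinc : s.Pairwise (· < ·)) : s.length ≤ ((insertionTableau w).headD []).length := by
  refine (length_le_countP_firstRow (b := s.sum + 1) hs hinc fun z hz => ?_).trans
    List.countP_le_length
  have := List.single_le_sum (fun _ _ => Nat.zero_le _) z hz
  omega

/-! ### Decreasing subsequences and the number of rows -/

/-- The reading word of a tableau: its rows, from bottom to top. -/
def readingWord : List (List ℕ) → List ℕ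
  | [] => []
  | r :: rs => readingWord rs ++ r

theorem length_le_one_of_sublist_sorted {r s : List ℕ} (hr : r.Pairwise (· ≤ ·))
    (hs : s.Sublist r) (hdec : s.Pairwise (· > ·)) : s = [] ∨ ∃ a ∈ r, s = [a] := by
  match s, hs, hdec with
  | [], _, _ => simp
  | [a], hs, _ => exact Or.inr ⟨a, by simpa using hs, rfl⟩
  | a :: b :: t, hs, hdec =>
    have h₁ := List.rel_of_pairwise_cons (hr.sublist hs) (List.mem_cons_self (a := b))
    have h₂ := List.rel_of_pairwise_cons hdec (List.mem_cons_self (a := b))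
    omega

theorem length_le_of_sublist_readingWord {T : List (List ℕ)}
    (hT : ∀ r ∈ T, r.Pairwise (· ≤ ·)) {s : List ℕ} (hs : s.Sublist (readingWord T))
    (hdec : s.Pairwise (· > ·)) : s.length ≤ T.length := by
  induction T generalizing s with
  | nil => simp [List.sublist_nil.1 hs]
  | cons r rs ih =>
    obtain ⟨s₁, s₂, rfl, h₁, h₂⟩ := List.sublist_append_iff.1 hs
    rw [List.pairwise_append] at hdec
    have := ih (fun r hr => hT r (by simp [hr])) h₁ hdec.1
    rcases length_le_one_of_sublist_sorted (hT r (by simp)) h₂ hdec.2.1 with rfl | ⟨a, -, rfl⟩ <;>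
      simp <;> omega

/-- Inserting a letter does not destroy decreasing subsequences: the reading word of the new
tableau has one of the same length as any in the old reading word followed by the letter. The lower
bound `b` is what lets the induction over the rows go through. -/
theorem exists_decreasing_tableauInsert {T : List (List ℕ)} (hT : ∀ r ∈ T, r.Pairwise (· ≤ ·))
    {x b : ℕ} {s : List ℕ} (hs : s.Sublist (readingWord T ++ [x])) (hdec : s.Pairwise (· > ·))
    (hb : ∀ e ∈ s, b < e) :
    ∃ s' : List ℕ, s'.Sublist (readingWord (tableauInsert x T)) ∧ s'.Pairwise (· > ·) ∧
      s'.length = s.length ∧ ∀ e ∈ s', b < e := by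
  induction T generalizing x b s with
  | nil => exact ⟨s, by simpa [readingWord, tableauInsert] using hs, hdec, rfl, hb⟩
  | cons r rs ih =>
    have hrs : ∀ r ∈ rs, r.Pairwise (· ≤ ·) := fun r hr => hT r (by simp [hr])
    rcases forall_le_or_exists_split x r with h | ⟨p, y, q, rfl, hp, hxy⟩
    · rw [tableauInsert_cons_of_forall_le rs h]
      exact ⟨s, by simpa [readingWord] using hs, hdec, rfl, hb⟩
    rw [tableauInsert_cons_of_split rs hp hxy, readingWord]
    have hr := hT (p ++ y :: q) (by simp)
    -- It suffices to find a decreasing part in the lower rows that stays above a final entry `a`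
    -- of the new first row.
    have glue : ∀ (t : List ℕ) (a : ℕ), a ∈ p ++ x :: q → b < a →
        t.Sublist (readingWord rs ++ [y]) → t.Pairwise (· > ·) → (∀ e ∈ t, a < e) →
        ∃ s' : List ℕ, s'.Sublist (readingWord (tableauInsert y rs) ++ (p ++ x :: q)) ∧
          s'.Pairwise (· > ·) ∧ s'.length = t.length + 1 ∧ ∀ e ∈ s', b < e := by
      intro t a ha hba ht htd hta
      obtain ⟨t', h₁, h₂, h₃, h₄⟩ := ih hrs ht htd hta
      refine ⟨t' ++ [a], h₁.append (by simpa using ha), ?_, by simp [h₃], ?_⟩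
      · simpa [List.pairwise_append, h₂] using h₄
      · intro e he
        rcases List.mem_append.1 he with he | he
        · exact hba.trans (h₄ e he)
        · simpa [List.mem_singleton.1 he] using hba
    have noglue : ∀ t : List ℕ, t.Sublist (readingWord rs ++ [y]) → t.Pairwise (· > ·) →
        (∀ e ∈ t, b < e) →
        ∃ s' : List ℕ, s'.Sublist (readingWord (tableauInsert y rs) ++ (p ++ x :: q)) ∧
          s'.Pairwise (· > ·) ∧ s'.length = t.length ∧ ∀ e ∈ s', b < e := by
      intro t ht htd htb
      obtain ⟨t', h₁, h₂, h₃, h₄⟩ := ih hrs ht htd htb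
      exact ⟨t', h₁.trans (List.sublist_append_left _ _), h₂, h₃, h₄⟩
    obtain ⟨s', s₃, rfl, hs', h₃⟩ := List.sublist_append_iff.1 hs
    obtain ⟨s₁, s₂, rfl, h₁, h₂⟩ := List.sublist_append_iff.1 hs'
    have h₁y : s₁.Sublist (readingWord rs ++ [y]) := h₁.trans (List.sublist_append_left _ _)
    rw [List.pairwise_append, List.pairwise_append] at hdec
    obtain ⟨⟨d₁, d₂, d₁₂⟩, -, d₃⟩ := hdec
    rcases length_le_one_of_sublist_sorted hr h₂ d₂ with rfl | ⟨a, ha, rfl⟩ <;>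
      rcases List.sublist_singleton.1 h₃ with rfl | rfl
    · simpa using noglue s₁ h₁y d₁ (by simpa using hb)
    · simpa using glue s₁ x (by simp) (hb x (by simp)) h₁y d₁ (by simpa using d₃)
    · by_cases hay : a = y
      · subst hay
        simpa using noglue (s₁ ++ [a]) (h₁.append (List.Sublist.refl _))
          (by simpa [List.pairwise_append, d₁] using d₁₂) (by simpa using hb)
      · have ha' : a ∈ p ++ x :: q := by
          simp only [List.mem_append, List.mem_cons] at ha ⊢
          tauto
        simpa using glue s₁ a ha' (hb a (by simp)) h₁y d₁ (by simpa using d₁₂)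
    · -- Both `a` and `x < a` occur: replace `a` by the bumped entry `y ≤ a`.
      have hxa : x < a := by simpa using d₃ a (by simp)
      have hya : y ≤ a := by
        simp only [List.mem_append, List.mem_cons] at ha
        rcases ha with ha | rfl | ha
        · have := hp a ha; omega
        · exact le_rfl
        · exact (List.pairwise_cons.1 (List.pairwise_append.1 hr).2.1).1 a ha
      have hy : ∀ e ∈ s₁, y < e := fun e he => hya.trans_lt (by simpa using d₁₂ e he)
      have := glue (s₁ ++ [y]) x (by simp) (hb x (by simp))
        (h₁.append (List.Sublist.refl _)) (by simpa [List.pairwise_append, d₁] using hy)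
        (by
          intro e he
          rcases List.mem_append.1 he with he | he
          · exact hxy.trans (hy e he)
          · simpa [List.mem_singleton.1 he] using hxy)
      simpa using this

theorem exists_decreasing_readingWord {w s : List ℕ} {b : ℕ} (hs : s.Sublist w)
    (hdec : s.Pairwise (· > ·)) (hb : ∀ e ∈ s, b < e) :
    ∃ s' : List ℕ, s'.Sublist (readingWord (insertionTableau w)) ∧ s'.Pairwise (· > ·) ∧
      s'.length = s.length ∧ ∀ e ∈ s', b < e := by
  induction w using List.reverseRecOn generalizing s b with
  | nil => exact ⟨s, by simpa [readingWord, insertionTableau] using hs, hdec, rfl, hb⟩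
  | append_singleton w x ih =>
    rw [insertionTableau_append_singleton]
    have hT : ∀ r ∈ insertionTableau w, r.Pairwise (· ≤ ·) := fun r hr =>
      (insertionTableau_sorted w r hr).2
    obtain ⟨s₁, s₂, rfl, h₁, h₂⟩ := List.sublist_append_iff.1 hs
    rw [List.pairwise_append] at hdec
    rcases List.sublist_singleton.1 h₂ with rfl | rfl
    · obtain ⟨t, k₁, k₂, k₃, k₄⟩ := ih h₁ hdec.1 fun e he => hb e (by simp [he])
      simpa [k₃] using exists_decreasing_tableauInsert hT
        (k₁.trans (List.sublist_append_left _ [x])) k₂ k₄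
    · obtain ⟨t, k₁, k₂, k₃, k₄⟩ := ih h₁ hdec.1 (b := x) fun e he => hdec.2.2 e he x (by simp)
      have hbx : b < x := hb x (by simp)
      simpa [k₃] using exists_decreasing_tableauInsert hT (b := b)
        (k₁.append (List.Sublist.refl [x])) (by simpa [List.pairwise_append, k₂] using k₄)
        (by
          intro e he
          rcases List.mem_append.1 he with he | he
          · exact hbx.trans (k₄ e he)
          · simpa [List.mem_singleton.1 he] using hbx)

/-- A word of positive letters has no decreasing subsequence longer than the number of rows of its
insertion tableau. -/
theorem length_le_length_insertionTableau {w s : List ℕ} (hw : ∀ e ∈ w, 0 < e)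
    (hs : s.Sublist w) (hdec : s.Pairwise (· > ·)) : s.length ≤ (insertionTableau w).length := by
  obtain ⟨t, h₁, h₂, h₃, -⟩ := exists_decreasing_readingWord hs hdec
    fun e he => hw e (hs.subset he)
  rw [← h₃]
  exact length_le_of_sublist_readingWord (fun r hr => (insertionTableau_sorted w r hr).2) h₁ h₂

/-! ### Robinson-Schensted insertion through hook tableaux -/

/-- `HookRun w L r c`: the letters of `w` are distinct, every nonempty prefix of `w` has an insertion
tableau of hook shape, that of `w` has first row `r` and remaining rows the single entries of `c`,
and `L` records for each letter after the first whether it extends the row (`true`) or bumps an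
entry out of it, onto the top of the column (`false`). -/
inductive HookRun : List ℕ → List Bool → List ℕ → List ℕ → Prop
  | single (x : ℕ) : HookRun [x] [] [x] []
  | arm {w : List ℕ} {L : List Bool} {r c : List ℕ} {x : ℕ} (h : HookRun w L r c) (hx : x ∉ w)
      (hr : ∀ z ∈ r, z < x) : HookRun (w ++ [x]) (L ++ [true]) (r ++ [x]) c
  | leg {w : List ℕ} {L : List Bool} {p q c : List ℕ} {x y : ℕ} (h : HookRun w L (p ++ y :: q) c)
      (hx : x ∉ w) (hp : ∀ z ∈ p, z < x) (hxy : x < y) (hc : ∀ z ∈ c, y < z) :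
      HookRun (w ++ [x]) (L ++ [false]) (p ++ x :: q) (y :: c)

namespace HookRun

variable {w : List ℕ} {L : List Bool} {r c : List ℕ}

theorem perm (h : HookRun w L r c) : w.Perm (r ++ c) := by
  rw [List.perm_iff_count]
  induction h with
  | single x => simp
  | arm h hx hr ih => intro a; have := ih a; simp only [List.count_append] at *; omega
  | leg h hx hp hxy hc ih =>
    intro a; have := ih a; simp only [List.count_append, List.count_cons, List.count_nil] at *; omega

theorem mem_iff (h : HookRun w L r c) {a : ℕ} : a ∈ w ↔ a ∈ r ∨ a ∈ c := by
  rw [h.perm.mem_iff, List.mem_append]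

theorem nodup (h : HookRun w L r c) : w.Nodup := by
  induction h with
  | single x => simp
  | arm h hx hr ih => exact List.nodup_append.2 ⟨ih, by simp, by rintro a ha b hb rfl; simp_all⟩
  | leg h hx hp hxy hc ih =>
    exact List.nodup_append.2 ⟨ih, by simp, by rintro a ha b hb rfl; simp_all⟩

theorem row_sorted (h : HookRun w L r c) : r.Pairwise (· < ·) := by
  induction h with
  | single x => simp
  | arm h hx hr ih => simpa [List.pairwise_append, ih] using hr
  | leg h hx hp hxy hc ih =>
    simp only [List.pairwise_append, List.pairwise_cons, List.mem_cons] at ih ⊢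
    refine ⟨ih.1, ⟨fun z hz => hxy.trans (ih.2.1.1 z hz), ih.2.1.2⟩, ?_⟩
    rintro a ha b (rfl | hb)
    · exact hp a ha
    · exact ih.2.2 a ha b (Or.inr hb)

theorem col_sorted (h : HookRun w L r c) : c.Pairwise (· < ·) := by
  induction h with
  | single x => simp
  | arm h hx hr ih => exact ih
  | leg h hx hp hxy hc ih => exact List.pairwise_cons.2 ⟨hc, ih⟩

theorem exists_lt_of_mem_col (h : HookRun w L r c) : ∀ z ∈ c, ∃ a ∈ r, a < z := by
  induction h with
  | single x => simp
  | arm h hx hr ih =>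
    intro z hz
    obtain ⟨a, ha, haz⟩ := ih z hz
    exact ⟨a, by simp [ha], haz⟩
  | leg h hx hp hxy hc ih =>
    intro z hz
    rcases List.mem_cons.1 hz with rfl | hz
    · exact ⟨_, by simp, hxy⟩
    · exact ⟨_, by simp, hxy.trans (hc z hz)⟩

theorem length_row (h : HookRun w L r c) : r.length = L.count true + 1 := by
  induction h with
  | single x => simp
  | arm h hx hr ih => simp [ih]
  | leg h hx hp hxy hc ih => simpa using ih

theorem length_add_length (h : HookRun w L r c) : r.length + c.length = w.length := by
  rw [h.perm.length_eq, List.length_append]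

theorem length_ascents (h : HookRun w L r c) : L.length + 1 = w.length := by
  induction h with
  | single x => simp
  | arm h hx hr ih => simp [ih]
  | leg h hx hp hxy hc ih => simp [ih]

theorem tableauInsert_column {y : ℕ} {c : List ℕ} (hc : (y :: c).Pairwise (· < ·)) :
    tableauInsert y (c.map fun z => [z]) = (y :: c).map fun z => [z] := by
  induction c generalizing y with
  | nil => rfl
  | cons d c ih =>
    rw [List.pairwise_cons] at hc
    have := tableauInsert_cons_of_split (p := []) (q := []) (c.map fun z => [z]) (by simp)
      (hc.1 d (by simp))
    simp only [List.nil_append] at this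
    rw [List.map_cons, this, ih hc.2]
    rfl

theorem insertionTableau_eq (h : HookRun w L r c) :
    insertionTableau w = r :: c.map fun z => [z] := by
  induction h with
  | single x => rfl
  | arm h hx hr ih =>
    rw [insertionTableau_append_singleton, ih,
      tableauInsert_cons_of_forall_le _ fun z hz => (hr z hz).le]
  | leg h hx hp hxy hc ih =>
    rw [insertionTableau_append_singleton, ih,
      tableauInsert_cons_of_split _ (fun z hz => (hp z hz).le) hxy,
      tableauInsert_column (List.pairwise_cons.2 ⟨hc, h.col_sorted⟩)]

end HookRun

theorem forall_length_le_one_of_tableauInsert {x : ℕ} {T : List (List ℕ)}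
    (h : ∀ r ∈ tableauInsert x T, r.length ≤ 1) : ∀ r ∈ T, r.length ≤ 1 := by
  induction T generalizing x with
  | nil => simp
  | cons r rs ih =>
    rcases forall_le_or_exists_split x r with hr | ⟨p, y, q, rfl, hp, hxy⟩
    · rw [tableauInsert_cons_of_forall_le rs hr] at h
      simp only [List.mem_cons, forall_eq_or_imp, List.length_append] at h ⊢
      exact ⟨by omega, h.2⟩
    · rw [tableauInsert_cons_of_split rs hp hxy] at h
      simp only [List.mem_cons, forall_eq_or_imp, List.length_append, List.length_cons] at h ⊢
      exact ⟨h.1, ih h.2⟩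

/-- A nonempty word of distinct letters whose insertion tableau has a hook shape has a hook run:
the shapes of its prefixes are hooks too. -/
theorem exists_hookRun {w : List ℕ} (hw : w.Nodup) (hne : w ≠ [])
    (h : ∀ r ∈ (insertionTableau w).tail, r.length ≤ 1) : ∃ L r c, HookRun w L r c := by
  induction w using List.reverseRecOn with
  | nil => exact absurd rfl hne
  | append_singleton w x ih =>
    rcases eq_or_ne w [] with rfl | hw0
    · exact ⟨_, _, _, HookRun.single x⟩
    have hx : x ∉ w := fun hx => (List.nodup_append.1 hw).2.2 x hx x (by simp) rfl
    rw [insertionTableau_append_singleton] at h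
    have htail : ∀ r ∈ (insertionTableau w).tail, r.length ≤ 1 := by
      cases hT : insertionTableau w with
      | nil => simp
      | cons r rs =>
        rw [hT] at h
        rcases forall_le_or_exists_split x r with hr | ⟨p, y, q, rfl, hp, hxy⟩
        · simpa [tableauInsert_cons_of_forall_le rs hr] using h
        · rw [tableauInsert_cons_of_split rs hp hxy] at h
          exact forall_length_le_one_of_tableauInsert h
    obtain ⟨L, r, c, hrun⟩ := ih (List.nodup_append.1 hw).1 hw0 htail
    rw [hrun.insertionTableau_eq] at h
    have hne' : ∀ z ∈ r, z ≠ x := by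
      rintro z hz rfl; exact hx (hrun.mem_iff.2 (Or.inl hz))
    rcases forall_le_or_exists_split x r with hr | ⟨p, y, q, rfl, hp, hxy⟩
    · exact ⟨_, _, _, hrun.arm hx fun z hz => lt_of_le_of_ne (hr z hz) (hne' z hz)⟩
    · refine ⟨_, _, _, hrun.leg hx
        (fun z hz => lt_of_le_of_ne (hp z hz) (hne' z (by simp [hz]))) hxy ?_⟩
      rw [tableauInsert_cons_of_split _ hp hxy, List.tail_cons] at h
      -- An entry not above the head of the column would create a row of length two.
      cases c with
      | nil => simp
      | cons d c =>
        have hyd : y < d := by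
          by_contra hyd
          rw [List.map_cons, tableauInsert_cons_of_forall_le _ (by simpa using hyd)] at h
          simpa using h _ (List.mem_cons_self)
        intro z hz
        rcases List.mem_cons.1 hz with rfl | hz
        · exact hyd
        · exact hyd.trans ((List.pairwise_cons.1 hrun.col_sorted).1 z hz)

namespace HookRun

variable {w : List ℕ} {L : List Bool} {r c : List ℕ}

/-! ### A run is determined by the ascents of its word and of the inverse -/

/-- The last letter stands in the row, and row entries exceeding it can no longer be bumped without
leaving the hook shapes, as they exceed an entry of the column. -/
theorem getLast_mem_row (h : HookRun w L r c) {l : ℕ} (hl : w.getLast? = some l) :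
    l ∈ r ∧ ∀ z ∈ r, l < z → ∃ d ∈ c, d < z := by
  induction h with
  | single x => simp_all
  | arm h hx hr ih =>
    simp only [List.getLast?_append, List.getLast?_singleton, Option.some_or,
      Option.some.injEq] at hl
    subst hl
    refine ⟨by simp, fun z hz hlt => ?_⟩
    rcases List.mem_append.1 hz with hz | hz
    · have := hr z hz; omega
    · simp at hz; omega
  | leg h hx hp hxy hc ih =>
    simp only [List.getLast?_append, List.getLast?_singleton, Option.some_or,
      Option.some.injEq] at hl
    subst hl
    refine ⟨by simp, fun z hz hlt => ⟨_, List.mem_cons_self, ?_⟩⟩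
    simp only [List.mem_append, List.mem_cons] at hz
    rcases hz with hz | rfl | hz
    · have := hp z hz; omega
    · omega
    · exact (List.pairwise_cons.1 (List.pairwise_append.1 h.row_sorted).2.1).1 z hz

/-- The letters extending the row are exactly those at the top of an ascent. -/
theorem ascents_getElem? (h : HookRun w L r c) (i : ℕ) (hi : i + 1 < w.length) :
    L[i]? = some (decide (w[i] < w[i + 1])) := by
  induction h with
  | single x => simp at hi
  | @arm w L r c x h hx hr ih =>
    have hlen := h.length_ascents
    simp only [List.length_append, List.length_singleton] at hi
    rcases lt_or_ge (i + 1) w.length with hi' | hi'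
    · rw [List.getElem?_append_left (by omega), ih hi']
      simp [hi', show i < w.length by omega]
    · have hiL : i = L.length := by omega
      have hlast : w.getLast? = some (w[i]'(by omega)) := by
        rw [List.getLast?_eq_getElem?, List.getElem?_eq_getElem (by omega)]
        simp only [Option.some.injEq]; congr 1; omega
      have := hr _ (h.getLast_mem_row hlast).1
      subst hiL
      simpa [List.getElem_append, show L.length < w.length by omega,
        show ¬ L.length + 1 < w.length by omega] using this
  | @leg w L p q c x y h hx hp hxy hc ih =>
    have hlen := h.length_ascents
    simp only [List.length_append, List.length_singleton] at hi
    rcases lt_or_ge (i + 1) w.length with hi' | hi'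
    · rw [List.getElem?_append_left (by omega), ih hi']
      simp [hi', show i < w.length by omega]
    · have hiL : i = L.length := by omega
      have hlast : w.getLast? = some (w[i]'(by omega)) := by
        rw [List.getLast?_eq_getElem?, List.getElem?_eq_getElem (by omega)]
        simp only [Option.some.injEq]; congr 1; omega
      obtain ⟨hmem, hgt⟩ := h.getLast_mem_row hlast
      have : x ≤ w[i]'(by omega) := by
        by_contra hlt
        obtain ⟨d, hd, hdy⟩ := hgt y (by simp) (by omega)
        have := hc d hd
        omega
      subst hiL
      simpa [List.getElem_append, show L.length < w.length by omega,
        show ¬ L.length + 1 < w.length by omega] using this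

theorem pair_sublist_append_singleton {u v x : ℕ} :
    [u, v].Sublist (w ++ [x]) ↔ [u, v].Sublist w ∨ u ∈ w ∧ v = x := by
  rw [List.sublist_append_iff]
  constructor
  · rintro ⟨s, t, hst, hs, ht⟩
    rcases List.sublist_singleton.1 ht with rfl | rfl
    · rw [List.append_nil] at hst; exact Or.inl (hst ▸ hs)
    · have : s = [u] ∧ v = x := by
        have := List.append_inj' (s₁ := [u]) (t₁ := [v]) hst rfl
        simpa [eq_comm] using this
      obtain ⟨rfl, rfl⟩ := this
      exact Or.inr ⟨by simpa using hs, rfl⟩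
  · rintro (h | ⟨hu, rfl⟩)
    · exact ⟨_, [], by simp, h, by simp⟩
    · exact ⟨[u], [v], rfl, by simpa using hu, by simp⟩

/-- For letters `u < v` with no letter of the word between them, `v` lies in the first row exactly
if `u` stands before `v`: the first row records the ascents of the inverse permutation. -/
theorem mem_row_iff (h : HookRun w L r c) {u v : ℕ} (hu : u ∈ w) (hv : v ∈ w) (huv : u < v)
    (hno : ∀ z ∈ w, u < z → v ≤ z) : v ∈ r ↔ [u, v].Sublist w := by
  induction h with
  | single x => simp at hu hv; omega
  | @arm w L r c x h hx hr ih =>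
    rw [pair_sublist_append_singleton]
    simp only [List.mem_append, List.mem_singleton] at hu hv hno ⊢
    have hno' : ∀ z ∈ w, u < z → v ≤ z := fun z hz => hno z (Or.inl hz)
    by_cases hvx : v = x
    · subst hvx
      have hu : u ∈ w := hu.resolve_right (by omega)
      simp [hu]
    have hv : v ∈ w := hv.resolve_right hvx
    by_cases hux : u = x
    · subst hux
      refine iff_of_false ?_ ?_
      · rintro (hvr | hvu)
        · have := hr v hvr; omega
        · omega
      · rintro (hs | ⟨hs, -⟩)
        · exact hx (hs.subset (by simp))
        · exact hx hs
    · simp [hvx, ih (hu.resolve_right hux) hv hno']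
  | @leg w L p q c x y h hx hp hxy hc ih =>
    have hy : y ∈ w := h.mem_iff.2 (by simp)
    have hsort := List.pairwise_append.1 h.row_sorted
    have hq := (List.pairwise_cons.1 hsort.2.1).1
    rw [pair_sublist_append_singleton]
    simp only [List.mem_append, List.mem_cons, List.not_mem_nil, or_false] at hu hv hno ih ⊢
    have hno' : ∀ z ∈ w, u < z → v ≤ z := fun z hz => hno z (Or.inl hz)
    by_cases hvx : v = x
    · subst hvx
      have hu : u ∈ w := hu.resolve_right (by omega)
      simp [hu]
    have hv : v ∈ w := hv.resolve_right hvx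
    by_cases hux : u = x
    · subst hux
      refine iff_of_false ?_ ?_
      · rintro (hvp | hvu | hvq)
        · have := hp v hvp; omega
        · omega
        · have := hno y (Or.inl hy) hxy
          have := hq v hvq
          omega
      · rintro (hs | ⟨hs, -⟩)
        · exact hx (hs.subset (by simp))
        · exact hx hs
    have hu : u ∈ w := hu.resolve_right hux
    have hvy : v ≠ y := by
      rintro rfl
      rcases h.mem_iff.1 hu with hur | huc
      · simp only [List.mem_append, List.mem_cons] at hur
        rcases hur with hup | rfl | huq
        · have := hp u hup
          have := hno x (Or.inr rfl) this
          omega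
        · omega
        · have := hq u huq; omega
      · have := hc u huc; omega
    simpa [hvx, hvy] using ih hu hv hno'

theorem of_nil {w r c} (h : HookRun w [] r c) : ∃ x, w = [x] ∧ r = [x] ∧ c = [] := by
  generalize hL : ([] : List Bool) = L at h
  cases h with
  | single x => exact ⟨x, rfl, rfl, rfl⟩
  | arm h hx hr => simp at hL
  | leg h hx hp hxy hc => simp at hL

theorem of_append_true {w L r c} (h : HookRun w (L ++ [true]) r c) :
    ∃ w₀ r₀ x, w = w₀ ++ [x] ∧ r = r₀ ++ [x] ∧ HookRun w₀ L r₀ c := by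
  generalize hL : L ++ [true] = L' at h
  cases h with
  | single x => simp at hL
  | arm h hx hr =>
    obtain ⟨rfl, -⟩ := List.append_inj' hL rfl
    exact ⟨_, _, _, rfl, rfl, h⟩
  | leg h hx hp hxy hc => simpa using (List.append_inj' hL rfl).2

theorem of_append_false {w L r c} (h : HookRun w (L ++ [false]) r c) :
    ∃ w₀ p q c₀ x y, w = w₀ ++ [x] ∧ r = p ++ x :: q ∧ c = y :: c₀ ∧ x < y ∧
      HookRun w₀ L (p ++ y :: q) c₀ := by
  generalize hL : L ++ [false] = L' at h
  cases h with
  | single x => simp at hL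
  | arm h hx hr => simpa using (List.append_inj' hL rfl).2
  | leg h hx hp hxy hc =>
    obtain ⟨rfl, -⟩ := List.append_inj' hL rfl
    exact ⟨_, _, _, _, _, _, rfl, rfl, rfl, hxy, h⟩

theorem filter_lt_of_split {p q : List ℕ} {x y : ℕ} (h : (p ++ y :: q).Pairwise (· < ·))
    (hxy : x < y) : (p ++ x :: q).filter (· < y) = p ++ [x] ∧
      (p ++ x :: q).filter (y ≤ ·) = q := by
  simp only [List.pairwise_append, List.pairwise_cons, List.mem_cons, forall_eq_or_imp] at h
  obtain ⟨-, ⟨hq, -⟩, hp⟩ := h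
  have h₁ : p.filter (· < y) = p := List.filter_eq_self.2 fun z hz => by simpa using (hp z hz).1
  have h₂ : q.filter (· < y) = [] := List.filter_eq_nil_iff.2 fun z hz => by simpa using (hq z hz).le
  have h₃ : p.filter (y ≤ ·) = [] := List.filter_eq_nil_iff.2 fun z hz => by
    simpa using (hp z hz).1
  have h₄ : q.filter (y ≤ ·) = q := List.filter_eq_self.2 fun z hz => by simpa using (hq z hz).le
  simp [h₁, h₂, h₃, h₄, hxy, hxy.not_ge]

/-- Reverse insertion: the tableau and the record of extensions and bumps determine the word. -/
theorem word_unique {w' : List ℕ} (h : HookRun w L r c) (h' : HookRun w' L r c) : w = w' := by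
  induction L using List.reverseRecOn generalizing w w' r c with
  | nil =>
    obtain ⟨x, rfl, rfl, -⟩ := h.of_nil
    obtain ⟨y, rfl, h, -⟩ := h'.of_nil
    exact h
  | append_singleton L b ih =>
    cases b with
    | true =>
      obtain ⟨w₁, r₁, x, rfl, rfl, h₁⟩ := h.of_append_true
      obtain ⟨w₂, r₂, x₂, rfl, hr, h₂⟩ := h'.of_append_true
      obtain ⟨rfl, hx⟩ := List.append_inj' hr rfl
      rw [ih h₁ h₂, hx]
    | false =>
      obtain ⟨w₁, p, q, c₁, x, y, rfl, rfl, rfl, hxy, h₁⟩ := h.of_append_false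
      obtain ⟨w₂, p₂, q₂, c₂, x₂, y₂, rfl, hr, hc, hxy₂, h₂⟩ := h'.of_append_false
      obtain ⟨rfl, rfl⟩ := List.cons.inj hc
      have e₁ := filter_lt_of_split h₁.row_sorted hxy
      have e₂ := filter_lt_of_split h₂.row_sorted hxy₂
      rw [hr] at e₁
      obtain ⟨rfl, hx⟩ := List.append_inj' (e₁.1.symm.trans e₂.1) rfl
      obtain rfl := e₁.2.symm.trans e₂.2
      rw [ih h₁ h₂, hx]

/-- Reverse insertion is always possible: every hook tableau and every record with the right numbers
of extensions and bumps come from a word. -/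
theorem exists_of_tableau (hr : r.Pairwise (· < ·)) (hc : c.Pairwise (· < ·))
    (hdisj : ∀ z ∈ r, z ∉ c) (hcorner : ∀ a ∈ r.head?, ∀ z ∈ c, a < z)
    (hLr : r.length = L.count true + 1) (hLc : c.length = L.count false) :
    ∃ w, HookRun w L r c := by
  induction L using List.reverseRecOn generalizing r c with
  | nil =>
    obtain ⟨x, rfl⟩ := List.length_eq_one_iff.1 hLr
    obtain rfl := List.length_eq_zero_iff.1 hLc
    exact ⟨_, single x⟩
  | append_singleton L b ih =>
    cases b with
    | true =>
      obtain ⟨r, x, rfl⟩ := List.eq_nil_or_concat' r |>.resolve_left (by rintro rfl; simp at hLr)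
      simp only [List.length_append, List.length_singleton, List.count_append,
        List.count_singleton_self] at hLr
      have hne : r ≠ [] := by rintro rfl; simp at hLr
      rw [List.pairwise_append] at hr
      obtain ⟨w, hw⟩ := ih (r := r) (c := c) hr.1 hc (fun z hz => hdisj z (by simp [hz]))
        (fun a ha => hcorner a (by simp [List.head?_append, Option.mem_def.1 ha])) (by omega)
        (by simpa using hLc)
      have hrx : ∀ z ∈ r, z < x := fun z hz => hr.2.2 z hz x (by simp)
      refine ⟨_, hw.arm ?_ hrx⟩
      rw [hw.mem_iff]
      rintro (hx | hx)
      · exact (hrx x hx).false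
      · exact hdisj x (by simp) hx
    | false =>
      obtain ⟨y, c, rfl⟩ := List.exists_cons_of_ne_nil (l := c) (by rintro rfl; simp at hLc)
      rw [List.pairwise_cons] at hc
      -- The entry `x` undoing the bump of `y` is the largest one of the row below `y`.
      obtain ⟨p, x, q, rfl, hxy, hq⟩ : ∃ p x q, r = p ++ x :: q ∧ x < y ∧ ∀ z ∈ q, y < z := by
        have hyr : y ∉ r := fun h => hdisj y h (by simp)
        have hhead : ∀ a ∈ r.head?, a < y := fun a ha => hcorner a ha y (by simp)
        have hne : r ≠ [] := by rintro rfl; simp at hLr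
        clear hLr hcorner hdisj hr
        induction r using List.reverseRecOn with
        | nil => exact absurd rfl hne
        | append_singleton r z ihr =>
          rcases lt_or_ge z y with hz | hz
          · exact ⟨r, z, [], rfl, hz, by simp⟩
          · have hz' : y < z := lt_of_le_of_ne hz fun h => hyr (by simp [h])
            have hr0 : r ≠ [] := by
              rintro rfl
              have := hhead z (by simp)
              omega
            obtain ⟨p, x, q, rfl, h₁, h₂⟩ := ihr (fun h => hyr (by simp [h]))
              (fun a ha => hhead a (by simp [List.head?_append, Option.mem_def.1 ha])) hr0
            refine ⟨p, x, q ++ [z], by simp, h₁, ?_⟩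
            intro a ha
            rcases List.mem_append.1 ha with ha | ha
            · exact h₂ a ha
            · simp at ha; omega
      simp only [List.pairwise_append, List.pairwise_cons, List.mem_cons, forall_eq_or_imp] at hr
      obtain ⟨w, hw⟩ := ih (r := p ++ y :: q) (c := c)
        (by
          simp only [List.pairwise_append, List.pairwise_cons, List.mem_cons, forall_eq_or_imp]
          exact ⟨hr.1, ⟨hq, hr.2.1.2⟩, fun a ha => ⟨(hr.2.2 a ha).1.trans hxy, (hr.2.2 a ha).2⟩⟩)
        hc.2
        (by
          intro z hz hzc
          simp only [List.mem_append, List.mem_cons] at hz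
          rcases hz with hz | rfl | hz
          · exact hdisj z (by simp [hz]) (by simp [hzc])
          · exact (hc.1 z hzc).false
          · exact hdisj z (by simp [hz]) (by simp [hzc]))
        (by
          intro a ha z hz
          cases p with
          | nil =>
            simp only [List.nil_append, List.head?_cons, Option.mem_def, Option.some.injEq] at ha
            exact ha ▸ hc.1 z hz
          | cons b p => exact hcorner a (by simpa using ha) z (by simp [hz]))
        (by simpa using hLr) (by simpa using hLc)
      refine ⟨_, hw.leg ?_ (fun z hz => (hr.2.2 z hz).1) hxy hc.1⟩
      rw [hw.mem_iff]
      rintro (hx | hx)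
      · simp only [List.mem_append, List.mem_cons] at hx
        rcases hx with hx | rfl | hx
        · exact (hr.2.2 x hx).1.false
        · exact hxy.false
        · exact (hr.2.1.1 x hx).false
      · exact hdisj x (by simp) (by simp [hx])

/-! ### Hook shapes and monotone subsequences -/

theorem exists_increasing_lt (h : HookRun w L r c) (b : ℕ) :
    ∃ s : List ℕ, s.Sublist w ∧ s.Pairwise (· < ·) ∧ (∀ z ∈ s, z < b) ∧
      s.length = r.countP (· < b) := by
  induction h generalizing b with
  | single x =>
    by_cases hx : x < b
    · exact ⟨[x], by simp [hx]⟩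
    · exact ⟨[], by simp [hx]⟩
  | @arm w L r c x h hx hr ih =>
    by_cases hxb : x < b
    · obtain ⟨s, h₁, h₂, h₃, h₄⟩ := ih x
      have e₁ : r.countP (· < x) = r.length := List.countP_eq_length.2 (by simpa using hr)
      have e₂ : r.countP (· < b) = r.length :=
        List.countP_eq_length.2 fun z hz => by simpa using (hr z hz).trans hxb
      refine ⟨s ++ [x], h₁.append (List.Sublist.refl _), ?_, ?_, ?_⟩
      · simpa [List.pairwise_append, h₂] using h₃
      · intro z hz
        rcases List.mem_append.1 hz with hz | hz
        · exact (h₃ z hz).trans hxb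
        · simpa [List.mem_singleton.1 hz] using hxb
      · simp [h₄, e₁, e₂, hxb]
    · obtain ⟨s, h₁, h₂, h₃, h₄⟩ := ih b
      exact ⟨s, h₁.trans (List.sublist_append_left _ _), h₂, h₃, by simp [h₄, hxb]⟩
  | @leg w L p q c x y h hx hp hxy hc ih =>
    by_cases hb : x < b ∧ b ≤ y
    · obtain ⟨hxb, hby⟩ := hb
      obtain ⟨s, h₁, h₂, h₃, h₄⟩ := ih x
      have hq := (List.pairwise_cons.1 (List.pairwise_append.1 h.row_sorted).2.1).1
      have e₁ : p.countP (· < x) = p.length := List.countP_eq_length.2 (by simpa using hp)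
      have e₂ : p.countP (· < b) = p.length :=
        List.countP_eq_length.2 fun z hz => by simpa using (hp z hz).trans hxb
      have e₃ : q.countP (· < x) = 0 := List.countP_eq_zero.2 fun z hz => by
        have := hq z hz
        simp only [decide_eq_true_eq]; omega
      have e₄ : q.countP (· < b) = 0 := List.countP_eq_zero.2 fun z hz => by
        have := hq z hz
        simp only [decide_eq_true_eq]; omega
      refine ⟨s ++ [x], h₁.append (List.Sublist.refl _), ?_, ?_, ?_⟩
      · simpa [List.pairwise_append, h₂] using h₃
      · intro z hz
        rcases List.mem_append.1 hz with hz | hz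
        · exact (h₃ z hz).trans hxb
        · simpa [List.mem_singleton.1 hz] using hxb
      · simp [h₄, e₁, e₂, e₃, e₄, hxb, hxy.le]
    · obtain ⟨s, h₁, h₂, h₃, h₄⟩ := ih b
      refine ⟨s, h₁.trans (List.sublist_append_left _ _), h₂, h₃, ?_⟩
      simp only [h₄, List.countP_append, List.countP_cons, decide_eq_true_eq]
      split_ifs <;> omega

theorem exists_increasing (h : HookRun w L r c) :
    ∃ s : List ℕ, s.Sublist w ∧ s.Pairwise (· < ·) ∧ s.length = r.length := by
  obtain ⟨s, h₁, h₂, -, h₃⟩ := h.exists_increasing_lt (r.sum + 1)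
  refine ⟨s, h₁, h₂, h₃.trans (List.countP_eq_length.2 fun z hz => ?_)⟩
  have := List.single_le_sum (fun _ _ => Nat.zero_le _) z hz
  simp only [decide_eq_true_eq]; omega

/-- A decreasing subsequence as long as the first column, corner included. For the induction it is
split into a part `s` bounded below by the top entry of `c` and a last letter `e` bounding from
above the row entries that the next letter may bump; a bumping letter then extends it, and a letter
appended to the row replaces `e` if it is below the top entry of `c`. -/
theorem exists_decreasing (h : HookRun w L r c) :
    ∃ (s : List ℕ) (e : ℕ), (s ++ [e]).Sublist w ∧ (s ++ [e]).Pairwise (· > ·) ∧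
      s.length = c.length ∧ (∀ a ∈ s, ∀ d ∈ c.head?, d ≤ a) ∧
      ∀ z ∈ r, (∀ d ∈ c.head?, z < d) → z ≤ e := by
  induction h with
  | single x => exact ⟨[], x, by simp⟩
  | @arm w L r c x h hx hr ih =>
    obtain ⟨s, e, h₁, h₂, h₃, h₄, h₅⟩ := ih
    have h₁' : s.Sublist w := (List.sublist_append_left _ _).trans h₁
    by_cases hxd : ∀ d ∈ c.head?, x < d
    · refine ⟨s, x, h₁'.append (List.Sublist.refl _), ?_, h₃, h₄, ?_⟩
      · rw [List.pairwise_append] at h₂ ⊢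
        refine ⟨h₂.1, by simp, fun a ha b hb => ?_⟩
        obtain rfl := List.mem_singleton.1 hb
        cases c with
        | nil => simp [List.length_eq_zero_iff.1 h₃] at ha
        | cons d c => exact (hxd d (by simp)).trans_le (h₄ a ha d (by simp))
      · intro z hz _
        rcases List.mem_append.1 hz with hz | hz
        · exact (hr z hz).le
        · exact (List.mem_singleton.1 hz).le
    · refine ⟨s, e, h₁.trans (List.sublist_append_left _ _), h₂, h₃, h₄, fun z hz hzd => ?_⟩
      rcases List.mem_append.1 hz with hz | hz
      · exact h₅ z hz hzd
      · exact absurd (List.mem_singleton.1 hz ▸ hzd) hxd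
  | @leg w L p q c x y h hx hp hxy hc ih =>
    obtain ⟨s, e, h₁, h₂, h₃, h₄, h₅⟩ := ih
    have hye : y ≤ e := h₅ y (by simp) fun d hd => hc d (List.mem_of_mem_head? hd)
    have hys : ∀ a ∈ s ++ [e], y ≤ a := by
      intro a ha
      rcases List.mem_append.1 ha with ha | ha
      · have := (List.pairwise_append.1 h₂).2.2 a ha e (by simp)
        omega
      · exact (List.mem_singleton.1 ha).symm ▸ hye
    refine ⟨s ++ [e], x, h₁.append (List.Sublist.refl _), ?_, by simp [h₃], by simpa using hys, ?_⟩
    · rw [List.pairwise_append]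
      refine ⟨h₂, by simp, fun a ha b hb => ?_⟩
      obtain rfl := List.mem_singleton.1 hb
      exact hxy.trans_le (hys a ha)
    · intro z hz hzd
      have hzy : z < y := hzd y (by simp)
      simp only [List.mem_append, List.mem_cons] at hz
      rcases hz with hz | rfl | hz
      · exact (hp z hz).le
      · exact le_rfl
      · have := (List.pairwise_cons.1 (List.pairwise_append.1 h.row_sorted).2.1).1 z hz
        omega

end HookRun

/-- A word of length `n` with an increasing and a decreasing subsequence whose lengths add up to
`n + 1` has a hook shape, because the first row and the first column of the insertion tableau then
exhaust its entries. Unlike the definition, this criterion is visibly invariant under inversion. -/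
theorem exists_hookRun_of_monotone {w s t : List ℕ} (hw : w.Nodup) (hpos : ∀ e ∈ w, 0 < e)
    (hne : w ≠ []) (hs : s.Sublist w) (hinc : s.Pairwise (· < ·)) (ht : t.Sublist w)
    (hdec : t.Pairwise (· > ·)) (hlen : s.length + t.length = w.length + 1) :
    ∃ L r c, HookRun w L r c := by
  apply exists_hookRun hw hne
  have h₁ := length_le_length_firstRow hs hinc
  have h₂ := length_le_length_insertionTableau hpos ht hdec
  have h₃ := sum_length_insertionTableau w
  have h₄ := insertionTableau_sorted w
  cases hT : insertionTableau w with
  | nil => simp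
  | cons r rs =>
    simp only [hT, List.headD_cons, List.length_cons, List.map_cons, List.sum_cons,
      List.mem_cons, forall_eq_or_imp] at h₁ h₂ h₃ h₄
    have hsum : (rs.map List.length).sum ≤ rs.length := by omega
    have hrs := h₄.2
    clear h₁ h₂ h₃ h₄ hT
    have key : ∀ l : List (List ℕ), (∀ a ∈ l, a ≠ [] ∧ a.Pairwise (· ≤ ·)) →
        l.length ≤ (l.map List.length).sum := by
      intro l hl
      induction l with
      | nil => simp
      | cons a l ih =>
        have := ih fun a ha => hl a (by simp [ha])
        have := List.length_pos_iff.2 (hl a (by simp)).1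
        simp; omega
    intro a ha
    obtain ⟨l₁, l₂, rfl⟩ := List.append_of_mem ha
    have k₁ := key l₁ fun a ha => hrs a (by simp [ha])
    have k₂ := key l₂ fun a ha => hrs a (by simp [ha])
    simp only [List.map_append, List.map_cons, List.sum_append, List.sum_cons, List.length_append,
      List.length_cons] at hsum
    omega

/-! ### Words of permutations -/

section Words

variable {n : ℕ} (π : Equiv.Perm (Fin n))

@[simp]
theorem length_word : (word π).length = n := by simp [word]

@[simp]
theorem getElem_word (i : ℕ) (h : i < (word π).length) :
    (word π)[i] = (π ⟨i, by simpa using h⟩ : ℕ) + 1 := by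
  simp [word]

theorem mem_word {e : ℕ} : e ∈ word π ↔ 1 ≤ e ∧ e ≤ n := by
  simp only [word, List.mem_ofFn]
  constructor
  · rintro ⟨i, rfl⟩; omega
  · rintro ⟨h₁, h₂⟩
    exact ⟨π.symm ⟨e - 1, by omega⟩, by simp; omega⟩

theorem nodup_word : (word π).Nodup := by
  refine List.nodup_ofFn.2 fun i j h => ?_
  simpa [Fin.val_inj] using h

theorem exists_word_eq {w : List ℕ} (hw : w.Nodup) (hlen : w.length = n)
    (hmem : ∀ e ∈ w, 1 ≤ e ∧ e ≤ n) : ∃ π : Equiv.Perm (Fin n), word π = w := by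
  subst hlen
  let f : Fin w.length → Fin w.length := fun i => ⟨w[i] - 1, by
    have := hmem w[i] (List.getElem_mem _); omega⟩
  have hf : Function.Injective f := by
    intro i j hij
    have hi := hmem w[i] (List.getElem_mem _)
    have hj := hmem w[j] (List.getElem_mem _)
    have : w[i] = w[j] := by
      have := Fin.val_eq_of_eq hij
      simp only [f] at this
      omega
    exact Fin.ext ((hw.getElem_inj_iff).1 this)
  refine ⟨Equiv.ofBijective f (Finite.injective_iff_bijective.1 hf), ?_⟩
  refine List.ext_getElem (by simp) fun i h₁ h₂ => ?_
  have := hmem w[i] (List.getElem_mem _)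
  simp only [getElem_word, Equiv.ofBijective_apply, f, Fin.getElem_fin]
  omega

theorem exists_sublist_word_iff {k : ℕ} (R : ℕ → ℕ → Prop) :
    (∃ s : List ℕ, s.Sublist (word π) ∧ s.Pairwise R ∧ s.length = k) ↔
      ∃ f : Fin k ↪o Fin n, ∀ i j, i < j → R (π (f i) + 1) (π (f j) + 1) := by
  constructor
  · rintro ⟨s, hs, hR, rfl⟩
    obtain ⟨f, hf⟩ := List.sublist_iff_exists_fin_orderEmbedding_get_eq.1 hs
    refine ⟨f.trans (Fin.castOrderIso (length_word π)).toOrderEmbedding, fun i j hij => ?_⟩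
    have := List.pairwise_iff_get.1 hR i j hij
    rw [hf, hf] at this
    simpa [Fin.cast] using this
  · rintro ⟨f, hf⟩
    refine ⟨List.ofFn fun i => (π (f i) : ℕ) + 1, ?_, ?_, by simp⟩
    · refine List.sublist_iff_exists_fin_orderEmbedding_get_eq.2
        ⟨((Fin.castOrderIso List.length_ofFn).toOrderEmbedding.trans f).trans
          (Fin.castOrderIso (length_word π).symm).toOrderEmbedding, fun i => ?_⟩
      simp [Fin.cast]
    · exact List.pairwise_ofFn.2 fun i j hij => hf i j hij

theorem pair_sublist_word_iff (a b : Fin n) :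
    [(a : ℕ) + 1, (b : ℕ) + 1].Sublist (word π) ↔ π⁻¹ a < π⁻¹ b := by
  constructor
  · intro h
    obtain ⟨f, hf⟩ := List.sublist_iff_exists_fin_orderEmbedding_get_eq.1 h
    have h₀ := hf ⟨0, by simp⟩
    have h₁ := hf ⟨1, by simp⟩
    simp only [List.get_eq_getElem, getElem_word, List.getElem_cons_zero,
      List.getElem_cons_succ, Nat.add_right_cancel_iff, Fin.val_inj] at h₀ h₁
    rw [h₀, h₁]
    simp
  · intro h
    have hget : ∀ e : Fin n, (word π)[(π⁻¹ e : ℕ)]'(by simp) = e + 1 := fun e => by simp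
    have hdrop := List.drop_eq_getElem_cons (l := word π) (i := π⁻¹ a) (by simp)
    have hb : (b : ℕ) + 1 ∈ (word π).drop (π⁻¹ a + 1) := by
      refine List.mem_drop_iff_getElem.2 ⟨π⁻¹ b - (π⁻¹ a + 1), by
        have := (π⁻¹ b).isLt
        rw [length_word]; omega, ?_⟩
      rw [← hget b]
      congr 1
      omega
    refine List.Sublist.trans ?_ (List.drop_sublist (π⁻¹ a) (word π))
    rw [hdrop, hget a]
    exact (List.singleton_sublist.2 hb).cons_cons _

theorem lis_eq_of_hookRun {L r c} (h : HookRun (word π) L r c) : lis π = r.length := by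
  apply le_antisymm
  · refine Finset.sup_le fun S hS => ?_
    have hS := (Finset.mem_filter.1 hS).2
    obtain ⟨s, h₁, h₂, h₃⟩ := (exists_sublist_word_iff π (· < ·) (k := S.card)).2
      ⟨S.orderEmbOfFin rfl, fun i j hij => by
        simpa using hS _ (S.orderEmbOfFin_mem rfl i) _ (S.orderEmbOfFin_mem rfl j)
          ((S.orderEmbOfFin rfl).strictMono hij)⟩
    have := length_le_length_firstRow h₁ h₂
    rw [h.insertionTableau_eq, h₃] at this
    simpa using this
  · obtain ⟨f, hf⟩ := (exists_sublist_word_iff π (· < ·)).1 h.exists_increasing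
    have hmem : Finset.univ.map f.toEmbedding ∈ (Finset.univ : Finset (Finset (Fin n))).filter
        fun S => ∀ i ∈ S, ∀ j ∈ S, i < j → π i < π j := by
      simp only [Finset.mem_filter, Finset.mem_univ, true_and, Finset.mem_map,
        forall_exists_index]
      rintro _ i rfl _ j rfl hij
      simpa using hf i j (f.lt_iff_lt.1 hij)
    simpa [lis] using Finset.le_sup (f := Finset.card) hmem

theorem shape_mem_hook_iff (hn : 1 ≤ n) :
    shape π ∈ hook n ↔ ∃ L r c, HookRun (word π) L r c := by
  constructor
  · rintro ⟨k, -, -, hk⟩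
    refine exists_hookRun (nodup_word π) (by
      intro h
      have := length_word π
      simp [h] at this; omega) fun a ha => ?_
    have : a.length ∈ (shape π).tail := by
      rw [shape, ← List.map_tail]
      exact List.mem_map_of_mem ha
    rw [hk] at this
    exact (List.eq_of_mem_replicate this).le
  · rintro ⟨L, r, c, h⟩
    have h₁ := h.length_add_length
    have h₂ := h.length_row
    rw [length_word] at h₁
    refine ⟨r.length, by omega, by omega, ?_⟩
    have : n - r.length = c.length := by omega
    rw [shape, h.insertionTableau_eq, this]
    simp [List.eq_replicate_iff]

/-- The inverse of a hook-shaped permutation is hook-shaped. -/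
theorem exists_hookRun_inv {L r c} (h : HookRun (word π) L r c) :
    ∃ L r c, HookRun (word π⁻¹) L r c := by
  obtain ⟨f, hf⟩ := (exists_sublist_word_iff π (· < ·)).1 h.exists_increasing
  obtain ⟨t, e, h₁, h₂, h₃, -⟩ := h.exists_decreasing
  obtain ⟨g, hg⟩ := (exists_sublist_word_iff π (· > ·)).1 ⟨t ++ [e], h₁, h₂, rfl⟩
  obtain ⟨s', k₁, k₂, k₃⟩ := (exists_sublist_word_iff π⁻¹ (· < ·) (k := r.length)).2
    ⟨OrderEmbedding.ofStrictMono (fun i => π (f i)) fun i j hij => by simpa using hf i j hij,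
      fun i j hij => by
        change (π⁻¹ (π (f i)) : ℕ) + 1 < π⁻¹ (π (f j)) + 1
        simpa using hij⟩
  obtain ⟨t', l₁, l₂, l₃⟩ := (exists_sublist_word_iff π⁻¹ (· > ·) (k := (t ++ [e]).length)).2
    ⟨OrderEmbedding.ofStrictMono (fun i => π (g i.rev)) fun i j hij => by
        simpa using hg j.rev i.rev (Fin.rev_lt_rev.2 hij),
      fun i j hij => by
        change (π⁻¹ (π (g i.rev)) : ℕ) + 1 > π⁻¹ (π (g j.rev)) + 1
        simpa using hij⟩
  have hlen := h.length_add_length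
  refine exists_hookRun_of_monotone (nodup_word _) (fun e he => ((mem_word _).1 he).1) ?_
    k₁ k₂ l₁ l₂ ?_
  · intro h0
    have h₁ := length_word π⁻¹
    have h₂ := h.length_row
    simp only [length_word] at hlen
    simp [h0] at h₁; omega
  · simp only [length_word, List.length_append, List.length_singleton] at hlen l₃ ⊢
    omega

end Words

/-! ### Ascent sets -/

section Ascents

variable {m : ℕ}

/-- The ascents of a permutation of `m + 1` letters, as a set of indices of adjacent positions. -/
def ascents (π : Equiv.Perm (Fin (m + 1))) : Finset (Fin m) :=
  Finset.univ.filter fun i => π i.castSucc < π i.succ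

/-- The indicator word of a set of adjacent positions. -/
def ascentRecord (A : Finset (Fin m)) : List Bool :=
  (List.finRange m).map fun i => decide (i ∈ A)

/-- The row, or arm, of the standard hook tableau on `1, …, m + 1` encoded by `B`: besides the
corner `1`, it has the letters `i + 2` with `i ∈ B`. The index `i` stands for the pair of adjacent
letters `i + 1`, `i + 2`. -/
def hookRow (B : Finset (Fin m)) : List ℕ :=
  1 :: ((List.finRange m).filter (· ∈ B)).map fun i : Fin m => (i : ℕ) + 2

/-- The column below the corner of the standard hook tableau on `1, …, m + 1` encoded by `B`. -/
def hookColumn (B : Finset (Fin m)) : List ℕ :=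
  ((List.finRange m).filter (· ∉ B)).map fun i : Fin m => (i : ℕ) + 2

theorem mem_hookRow {B : Finset (Fin m)} {v : ℕ} :
    v ∈ hookRow B ↔ v = 1 ∨ ∃ i ∈ B, (i : ℕ) + 2 = v := by
  simp [hookRow]

theorem mem_hookColumn {B : Finset (Fin m)} {v : ℕ} :
    v ∈ hookColumn B ↔ ∃ i ∉ B, (i : ℕ) + 2 = v := by
  simp [hookColumn]

theorem pairwise_finRange_filter_map (p : Fin m → Bool) :
    (((List.finRange m).filter p).map fun i : Fin m => (i : ℕ) + 2).Pairwise (· < ·) := by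
  rw [List.pairwise_map]
  refine List.Pairwise.filter _ ((List.pairwise_lt_finRange m).imp fun h => ?_)
  simpa using h

theorem hookRow_sorted (B : Finset (Fin m)) : (hookRow B).Pairwise (· < ·) := by
  refine List.pairwise_cons.2 ⟨?_, pairwise_finRange_filter_map _⟩
  simp

theorem hookColumn_sorted (B : Finset (Fin m)) : (hookColumn B).Pairwise (· < ·) :=
  pairwise_finRange_filter_map _

theorem countP_finRange_mem (B : Finset (Fin m)) :
    (List.finRange m).countP (· ∈ B) = B.card := by
  rw [List.countP_eq_length_filter,
    ← List.toFinset_card_of_nodup ((List.nodup_finRange m).filter _)]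
  congr 1
  ext i
  simp

theorem length_hookRow (B : Finset (Fin m)) : (hookRow B).length = B.card + 1 := by
  simp [hookRow, ← List.countP_eq_length_filter, countP_finRange_mem]

theorem length_hookColumn (B : Finset (Fin m)) : (hookColumn B).length + B.card = m := by
  have := List.length_eq_countP_add_countP (fun i => decide (i ∈ B)) (l := List.finRange m)
  rw [countP_finRange_mem, List.length_finRange] at this
  rw [hookColumn, List.length_map, ← List.countP_eq_length_filter]
  simp only [decide_not, decide_eq_true_eq] at this ⊢
  omega

theorem count_true_ascentRecord (A : Finset (Fin m)) : (ascentRecord A).count true = A.card := by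
  rw [← countP_finRange_mem, ascentRecord, List.count, List.countP_map]
  congr 1
  ext i
  simp

theorem length_ascentRecord (A : Finset (Fin m)) : (ascentRecord A).length = m := by
  simp [ascentRecord]

theorem count_false_ascentRecord (A : Finset (Fin m)) :
    (ascentRecord A).count false + A.card = m := by
  have := List.count_true_add_count_false (l := ascentRecord A)
  rw [length_ascentRecord, count_true_ascentRecord] at this
  omega

theorem ascentRecord_injective : Function.Injective (ascentRecord (m := m)) := by
  intro A B h
  ext i
  have := List.map_inj_left.1 h i (List.mem_finRange i)
  simpa using this

theorem hookRow_injective : Function.Injective (hookRow (m := m)) := by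
  intro A B h
  ext i
  have : (i : ℕ) + 2 ∈ hookRow A ↔ (i : ℕ) + 2 ∈ hookRow B := by rw [h]
  simpa [mem_hookRow, Fin.val_inj] using this

variable {π : Equiv.Perm (Fin (m + 1))} {L : List Bool} {r c : List ℕ}

/-- With `eq_hookRow` and `eq_hookColumn`: the whole run can be read off from the ascents of the
permutation and of its inverse. -/
theorem eq_ascentRecord (h : HookRun (word π) L r c) : L = ascentRecord (ascents π) := by
  have hlen := h.length_ascents
  rw [length_word] at hlen
  refine List.ext_getElem? fun i => ?_
  rcases lt_or_ge i m with hi | hi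
  · rw [h.ascents_getElem? i (by simpa using hi)]
    simp [ascentRecord, ascents, hi]
  · rw [List.getElem?_eq_none (by omega), List.getElem?_eq_none (by rwa [length_ascentRecord])]

theorem mem_row_iff_mem_hookRow (h : HookRun (word π) L r c) {v : ℕ} :
    v ∈ r ↔ v ∈ hookRow (ascents π⁻¹) := by
  have hmem : ∀ {e}, e ∈ r → 1 ≤ e ∧ e ≤ m + 1 := fun he =>
    (mem_word π).1 (h.mem_iff.2 (Or.inl he))
  have key : ∀ i : Fin m, (i : ℕ) + 2 ∈ r ↔ i ∈ ascents π⁻¹ := by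
    intro i
    rw [h.mem_row_iff (u := i + 1) ((mem_word π).2 (by omega)) ((mem_word π).2 (by omega))
      (by omega) (by omega)]
    simpa [ascents] using pair_sublist_word_iff π i.castSucc i.succ
  rw [mem_hookRow]
  constructor
  · intro hv
    have := hmem hv
    rcases eq_or_ne v 1 with rfl | hv1
    · exact Or.inl rfl
    · refine Or.inr ⟨⟨v - 2, by omega⟩, (key _).1 ?_, by simp; omega⟩
      rwa [show v - 2 + 2 = v by omega]
  · rintro (rfl | ⟨i, hi, rfl⟩)
    · refine (h.mem_iff.1 ((mem_word π).2 (by omega))).resolve_right fun h1 => ?_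
      obtain ⟨a, ha, hlt⟩ := h.exists_lt_of_mem_col _ h1
      have := hmem ha
      omega
    · exact (key i).2 hi

theorem eq_of_sorted_of_mem_iff {l₁ l₂ : List ℕ} (h₁ : l₁.Pairwise (· < ·))
    (h₂ : l₂.Pairwise (· < ·)) (h : ∀ a, a ∈ l₁ ↔ a ∈ l₂) : l₁ = l₂ := by
  refine List.Perm.eq_of_pairwise (le := (· < ·)) (fun a b _ _ hab hba => by omega) h₁ h₂ ?_
  exact (List.perm_ext_iff_of_nodup (h₁.imp fun h => h.ne) (h₂.imp fun h => h.ne)).2 h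

theorem eq_hookRow (h : HookRun (word π) L r c) : r = hookRow (ascents π⁻¹) :=
  eq_of_sorted_of_mem_iff h.row_sorted (hookRow_sorted _) fun _ => mem_row_iff_mem_hookRow h

theorem eq_hookColumn (h : HookRun (word π) L r c) : c = hookColumn (ascents π⁻¹) := by
  refine eq_of_sorted_of_mem_iff h.col_sorted (hookColumn_sorted _) fun v => ?_
  have hdisj := (List.nodup_append.1 (h.perm.nodup_iff.1 h.nodup)).2.2
  have hv : v ∈ c ↔ v ∈ word π ∧ v ∉ r := by
    rw [h.mem_iff]
    constructor
    · exact fun hc => ⟨Or.inr hc, fun hr => hdisj v hr v hc rfl⟩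
    · rintro ⟨hr | hc, hn⟩
      · exact absurd hr hn
      · exact hc
  rw [hv, mem_row_iff_mem_hookRow h, mem_word, mem_hookRow, mem_hookColumn]
  constructor
  · rintro ⟨h₁, h₂⟩
    push Not at h₂
    exact ⟨⟨v - 2, by omega⟩, fun hi => h₂.2 _ hi (by simp; omega), by simp; omega⟩
  · rintro ⟨i, hi, rfl⟩
    refine ⟨by omega, ?_⟩
    rintro (h | ⟨j, hj, hji⟩)
    · omega
    · obtain rfl : j = i := Fin.ext (by omega)
      exact hi hj

/-- Hook-shaped permutations are determined by their ascents and those of their inverses. -/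
theorem eq_of_ascents_eq {σ : Equiv.Perm (Fin (m + 1))} {L' r' c'}
    (h : HookRun (word π) L r c) (h' : HookRun (word σ) L' r' c')
    (h₁ : ascents π = ascents σ) (h₂ : ascents π⁻¹ = ascents σ⁻¹) : π = σ := by
  obtain rfl : L = L' := by rw [eq_ascentRecord h, eq_ascentRecord h', h₁]
  obtain rfl : r = r' := by rw [eq_hookRow h, eq_hookRow h', h₂]
  obtain rfl : c = c' := by rw [eq_hookColumn h, eq_hookColumn h', h₂]
  have hw := h.word_unique h'
  ext i
  have := List.ofFn_injective hw
  simpa using congrFun this i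

/-- Any two sets of the same size are the ascent sets of a hook-shaped permutation and its inverse.
-/
theorem exists_ascents_eq {A B : Finset (Fin m)} (hAB : A.card = B.card) :
    ∃ π : Equiv.Perm (Fin (m + 1)), (∃ L r c, HookRun (word π) L r c) ∧
      ascents π = A ∧ ascents π⁻¹ = B := by
  have hdisj : ∀ z ∈ hookRow B, z ∉ hookColumn B := by
    intro z hz hzc
    rw [mem_hookColumn] at hzc
    rw [mem_hookRow] at hz
    obtain ⟨i, hi, rfl⟩ := hzc
    rcases hz with h | ⟨j, hj, hji⟩
    · omega
    · obtain rfl : j = i := Fin.ext (by omega)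
      exact hi hj
  have hA := count_false_ascentRecord A
  have hB := length_hookColumn B
  obtain ⟨w, hw⟩ := HookRun.exists_of_tableau (L := ascentRecord A) (hookRow_sorted B)
    (hookColumn_sorted B) hdisj
    (by
      intro a ha z hz
      obtain rfl : 1 = a := by simpa [hookRow] using ha
      obtain ⟨i, -, rfl⟩ := mem_hookColumn.1 hz
      omega)
    (by rw [length_hookRow, count_true_ascentRecord, hAB]) (by omega)
  obtain ⟨π, rfl⟩ := exists_word_eq (n := m + 1) hw.nodup
    (by rw [← hw.length_add_length, length_hookRow]; omega)
    (by
      intro e he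
      rcases hw.mem_iff.1 he with he | he
      · rcases mem_hookRow.1 he with rfl | ⟨i, -, rfl⟩ <;> omega
      · obtain ⟨i, -, rfl⟩ := mem_hookColumn.1 he
        omega)
  exact ⟨π, ⟨_, _, _, hw⟩, (ascentRecord_injective (eq_ascentRecord hw)).symm,
    (hookRow_injective (eq_hookRow hw)).symm⟩

theorem card_ascents (h : HookRun (word π) L r c) : (ascents π).card + 1 = lis π := by
  rw [lis_eq_of_hookRun π h, h.length_row, eq_ascentRecord h, count_true_ascentRecord]

theorem card_ascents_inv (h : HookRun (word π) L r c) : (ascents π⁻¹).card + 1 = lis π := by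
  rw [lis_eq_of_hookRun π h, eq_hookRow h, length_hookRow]

/-! ### Counting -/

/-- `π ↦ (ascents π, ascents π⁻¹)` is a bijection onto the pairs of `k`-sets. -/
theorem permCount_hook (m k : ℕ) :
    permCount (m + 1) (hook (m + 1)) (k + 1) = m.choose k ^ 2 := by
  have himage : (fun π : Equiv.Perm (Fin (m + 1)) => (ascents π, ascents π⁻¹)) ''
      {π | lis π = k + 1 ∧ shape π ∈ hook (m + 1)} =
      ↑((Finset.univ : Finset (Fin m)).powersetCard k ×ˢ
        (Finset.univ : Finset (Fin m)).powersetCard k) := by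
    ext ⟨A, B⟩
    simp only [Set.mem_image, Set.mem_ofPred_eq, shape_mem_hook_iff _ (Nat.le_add_left 1 m),
      Finset.coe_product, Set.mem_prod, Finset.mem_coe, Finset.mem_powersetCard_univ,
      Prod.mk.injEq]
    constructor
    · rintro ⟨π, ⟨hlis, L, r, c, h⟩, rfl, rfl⟩
      have := card_ascents h
      have := card_ascents_inv h
      omega
    · rintro ⟨hA, hB⟩
      obtain ⟨π, ⟨L, r, c, h⟩, rfl, rfl⟩ := exists_ascents_eq (hA.trans hB.symm)
      exact ⟨π, ⟨by rw [← card_ascents h, hA], L, r, c, h⟩, rfl, rfl⟩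
  have hinj : Set.InjOn (fun π : Equiv.Perm (Fin (m + 1)) => (ascents π, ascents π⁻¹))
      {π | lis π = k + 1 ∧ shape π ∈ hook (m + 1)} := by
    rintro π ⟨-, hπ⟩ σ ⟨-, hσ⟩ h
    obtain ⟨L, r, c, hπ⟩ := (shape_mem_hook_iff _ (Nat.le_add_left 1 m)).1 hπ
    obtain ⟨L', r', c', hσ⟩ := (shape_mem_hook_iff _ (Nat.le_add_left 1 m)).1 hσ
    exact eq_of_ascents_eq hπ hσ (Prod.mk.inj h).1 (Prod.mk.inj h).2
  rw [permCount, ← hinj.ncard_image, himage, Set.ncard_coe_finset,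
    Finset.card_product, Finset.card_powersetCard, Finset.card_univ, Fintype.card_fin, sq]

/-- On involutions the two ascent sets agree, and `ascents` is a bijection onto the `k`-sets. -/
theorem involCount_hook (m k : ℕ) :
    involCount (m + 1) (hook (m + 1)) (k + 1) = m.choose k := by
  have himage : ascents ''
      {π : Equiv.Perm (Fin (m + 1)) | π ^ 2 = 1 ∧ lis π = k + 1 ∧ shape π ∈ hook (m + 1)} =
      ↑((Finset.univ : Finset (Fin m)).powersetCard k) := by
    ext A
    simp only [Set.mem_image, Set.mem_ofPred_eq, shape_mem_hook_iff _ (Nat.le_add_left 1 m),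
      Finset.mem_coe, Finset.mem_powersetCard_univ]
    constructor
    · rintro ⟨π, ⟨-, hlis, L, r, c, h⟩, rfl⟩
      have := card_ascents h
      omega
    · intro hA
      obtain ⟨π, ⟨L, r, c, h⟩, h₁, h₂⟩ := exists_ascents_eq (A := A) (B := A) rfl
      -- The inverse has the same pair of ascent sets, so it is the same permutation.
      obtain ⟨L', r', c', h'⟩ := exists_hookRun_inv π h
      have hinv : π = π⁻¹ := eq_of_ascents_eq h h' (h₁.trans h₂.symm)
        (by rw [inv_inv, h₁, h₂])
      refine ⟨π, ⟨?_, by rw [← card_ascents h, h₁, hA], L, r, c, h⟩, h₁⟩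
      rw [sq]
      nth_rewrite 2 [hinv]
      exact mul_inv_cancel π
  have hinj : Set.InjOn ascents
      {π : Equiv.Perm (Fin (m + 1)) | π ^ 2 = 1 ∧ lis π = k + 1 ∧ shape π ∈ hook (m + 1)} := by
    rintro π ⟨hπ2, -, hπ⟩ σ ⟨hσ2, -, hσ⟩ h
    obtain ⟨L, r, c, hπ⟩ := (shape_mem_hook_iff _ (Nat.le_add_left 1 m)).1 hπ
    obtain ⟨L', r', c', hσ⟩ := (shape_mem_hook_iff _ (Nat.le_add_left 1 m)).1 hσ
    refine eq_of_ascents_eq hπ hσ h ?_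
    rw [inv_eq_of_mul_eq_one_left (sq π ▸ hπ2), inv_eq_of_mul_eq_one_left (sq σ ▸ hσ2), h]
  rw [involCount, ← hinj.ncard_image, himage, Set.ncard_coe_finset,
    Finset.card_powersetCard, Finset.card_univ, Fintype.card_fin]

end Ascents

/-! ### Log concavity -/

theorem choose_mul_choose_add_two_le (m j : ℕ) :
    m.choose j * m.choose (j + 2) ≤ m.choose (j + 1) ^ 2 := by
  rcases lt_or_ge m (j + 1) with h | h
  · simp [Nat.choose_eq_zero_of_lt (show m < j + 2 by omega)]
  · obtain ⟨d, rfl⟩ := Nat.exists_eq_add_of_le h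
    have h₁ := Nat.choose_succ_right_eq (j + 1 + d) j
    have h₂ := Nat.choose_succ_right_eq (j + 1 + d) (j + 1)
    rw [show j + 1 + d - j = d + 1 by omega] at h₁
    rw [show j + 1 + d - (j + 1) = d by omega, show j + 1 + 1 = j + 2 from rfl] at h₂
    set a := (j + 1 + d).choose j
    set b := (j + 1 + d).choose (j + 1)
    set c := (j + 1 + d).choose (j + 2)
    refine Nat.le_of_mul_le_mul_right (c := (d + 1) * (j + 2)) ?_ (by positivity)
    calc a * c * ((d + 1) * (j + 2)) = (a * (d + 1)) * (c * (j + 2)) := by ring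
      _ = b ^ 2 * ((j + 1) * d) := by rw [← h₁, h₂]; ring
      _ ≤ b ^ 2 * ((d + 1) * (j + 2)) := by
        gcongr b ^ 2 * ?_
        rw [mul_comm]
        exact Nat.mul_le_mul (by omega) (by omega)

theorem isLogConcave_of_succ {m : ℕ} {a : ℕ → ℝ}
    (h : ∀ j, a (j + 1) * a (j + 3) ≤ a (j + 2) ^ 2) : IsLogConcave (m + 1) a := by
  intro k h₁ h₂
  by_cases hk : 2 ≤ k ∧ k ≤ m
  · obtain ⟨j, rfl⟩ := Nat.exists_eq_add_of_le' hk.1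
    simpa [entry, hk.2, h₂, show j ≤ m by omega, show j + 1 ≤ m by omega] using h j
  · have : entry (m + 1) a (k - 1) * entry (m + 1) a (k + 1) = 0 := by
      rw [mul_eq_zero]
      by_cases hk2 : 2 ≤ k
      · exact Or.inr (if_neg (by omega))
      · exact Or.inl (if_neg (by omega))
    rw [this]
    positivity

end HookLIS

theorem theorem3p1 (n : ℕ) :
    HookLIS.IsLogConcave n (fun k => (HookLIS.permCount n (HookLIS.hook n) k : ℝ)) ∧
    HookLIS.IsLogConcave n (fun k => (HookLIS.involCount n (HookLIS.hook n) k : ℝ)) := by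
  cases n with
  | zero => exact ⟨fun k h₁ h₂ => by omega, fun k h₁ h₂ => by omega⟩
  | succ m =>
    refine ⟨HookLIS.isLogConcave_of_succ fun j => ?_, HookLIS.isLogConcave_of_succ fun j => ?_⟩
    · simp only [HookLIS.permCount_hook]
      have := Nat.pow_le_pow_left (HookLIS.choose_mul_choose_add_two_le m j) 2
      rw [mul_pow] at this
      exact_mod_cast this
    · simp only [HookLIS.involCount_hook]
      exact_mod_cast HookLIS.choose_mul_choose_add_two_le m j
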